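/- Let $\varphi\colon\Gamma\to G$ be a homomorphism of finite groups. Definitions. A normal map (crossed module) $n\colon M\to H$ is a homomorphism together with an action of $H$ on $M$ by automorphisms such that $n({}^{h}m)=h\,n(m)\,h^{-1}$ and ${}^{n(m)}m'=m\,m'\,m^{-1}$. The free normal closure of a homomorphism $\alpha\colon\Lambda\to H$ is the universal (initial) factorization $\Lambda\to\Lambda^{\alpha}\to H$ of $\alpha$ whose second map is a normal map; morphisms of such factorizations are the homomorphisms compatible with the maps from $\Lambda$, the maps to $H$ and the actions of $H$. The normal closures tower of $\alpha$ is given by $\Lambda_{1,\alpha}=H$, $\alpha_1=\alpha$, where $\Lambda\xrightarrow{\alpha_{i+1}}\Lambda_{i+1,\alpha}\to\Lambda_{i,\alpha}$ is the free normal closure of $\alpha_i\colon\Lambda\to\Lambda_{i,\alpha}$. Put $\Lambda_{\infty,\alpha}=\varprojlim_i\Lambda_{i,\alpha}$, and let $\alpha_\infty\colon\Lambda\to\Lambda_{\infty,\alpha}$ be the induced map. The tower terminates at $t$ if the maps $\Lambda_{i+1,\alpha}\to\Lambda_{i,\alpha}$ are isomorphisms for all $i\ge t$. Let $C_0=G$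 and let $C_{i+1}=\langle\varphi(\Gamma)^{C_i}\rangle$ be the normal closure of $\varphi(\Gamma)$ in $C_i$; let $K_1=\ker\varphi$ and $K_{i+1}=[\Gamma,K_i]$. As $\Gamma$ and $G$ are finite, both decreasing series become constant; let $\mathcal C$ (the subnormal closure of $\varphi(\Gamma)$ in $G$) and $\mathcal K$ be their respective terminal members. Let $\rho\colon\Gamma\to\mathcal C$ and $\psi\colon\Gamma/\mathcal K\to\mathcal C$ be the maps induced by $\varphi$. Then: 1. There is an isomorphism $\Gamma_{\infty,\varphi}\cong\Gamma_{\infty,\rho}$ compatible with $\varphi_\infty$ and $\rho_\infty$ and with the maps to $G$; and $\Gamma_{\infty,\rho}=(\Gamma/\mathcal K)_{\infty,\psi}$, in the sense that there are isomorphisms $\Gamma_{i,\rho}\cong(\Gamma/\mathcal K)_{i,\psi}$ for all $i\ge 1$, equal to the identity of $\mathcal C$ for $i=1$ and compatible with the structure maps of the towers and with the maps $\rho_i$ and $\psi_i$, which therefore induce an isomorphism of the inverse limits. 2. The towers $\{\Gamma_{i,\rho}\}$ and $\{(\Gamma/\mathcal K)_{i,\psi}\}$ terminate, and whenever they terminate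 at $t_1$ and $t_2$ respectively, the isomorphisms of part 1 followed by the projections from the inverse limits give isomorphisms $\Gamma_{\infty,\varphi}\cong\Gamma_{t_1,\rho}$ and $\Gamma_{\infty,\varphi}\cong(\Gamma/\mathcal K)_{t_2,\psi}$. 3. $\Gamma_{\infty,\varphi}$ is finite and $|\Gamma_{\infty,\varphi}|\le|\Gamma/\mathcal K|\cdot g(|\mathcal C|)$, where $g(1)=1$ and, for an integer $t\ge 2$ with least prime divisor $p$, $g(t)=t^{(\log_p t+1)/2}$. -/

import Mathlib

universe u v w

noncomputable section

namespace SubnormalTower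

/-- A normal map (crossed module) `M → G`: a homomorphism `hom` with an action of `G` on `M` by
automorphisms such that `hom` is equivariant (for conjugation on `G`) and the Peiffer identity
holds. -/
structure NormalMap (M : Type v) (G : Type w) [Group M] [Group G] where
  hom : M →* G
  act : G →* MulAut M
  hom_act : ∀ (g : G) (m : M), hom (act g m) = g * hom m * g⁻¹
  peiffer : ∀ m m' : M, act (hom m) m' = m * m' * m⁻¹

section NormalClosure

variable {Γ : Type u} {G : Type v} [Group Γ] [Group G]

/-- The relations of the free normal closure of `φ : Γ → G` on the generators `(g, a) ∈ G × Γ`;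
the generator `(g, a)` stands for the translate by `g` of the image of `a`. -/
inductive NormalClosureRel (φ : Γ →* G) : FreeGroup (G × Γ) → Prop
  | mul (g : G) (a b : Γ) : NormalClosureRel φ
      (FreeGroup.of (g, a) * FreeGroup.of (g, b) * (FreeGroup.of (g, a * b))⁻¹)
  | peiffer (g h : G) (a b : Γ) : NormalClosureRel φ
      (FreeGroup.of (g, a) * FreeGroup.of (h, b) * (FreeGroup.of (g, a))⁻¹ *
        (FreeGroup.of (g * φ a * g⁻¹ * h, b))⁻¹)

/-- The free normal closure of `φ : Γ → G`. See `NormalClosure.existsUnique_lift` for its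
universal property. -/
abbrev NormalClosure (φ : Γ →* G) : Type (max u v) :=
  PresentedGroup {r | NormalClosureRel φ r}

namespace NormalClosure

variable (φ : Γ →* G)

/-- The generator `(g, a)` of the free normal closure. -/
def gen (g : G) (a : Γ) : NormalClosure φ := PresentedGroup.of (g, a)

theorem gen_mul (g : G) (a b : Γ) : gen φ g (a * b) = gen φ g a * gen φ g b := by
  have h := PresentedGroup.one_of_mem (rels := {r | NormalClosureRel φ r})
    (NormalClosureRel.mul g a b)
  rw [map_mul, map_mul, map_inv, mul_inv_eq_one] at h
  exact h.symm

theorem gen_conj (g h : G) (a b : Γ) :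
    gen φ g a * gen φ h b * (gen φ g a)⁻¹ = gen φ (g * φ a * g⁻¹ * h) b := by
  have h := PresentedGroup.one_of_mem (rels := {r | NormalClosureRel φ r})
    (NormalClosureRel.peiffer g h a b)
  rw [map_mul, map_mul, map_mul, map_inv, map_inv, mul_inv_eq_one] at h
  exact h

variable {φ} in
/-- Homomorphisms out of the free normal closure. -/
def toGroup {M : Type w} [Group M] (f : G → Γ → M)
    (h₁ : ∀ g a b, f g (a * b) = f g a * f g b)
    (h₂ : ∀ g h a b, f g a * f h b * (f g a)⁻¹ = f (g * φ a * g⁻¹ * h) b) :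
    NormalClosure φ →* M :=
  PresentedGroup.toGroup (f := fun x : G × Γ => f x.1 x.2) (by
    rintro _ (⟨g, a, b⟩ | ⟨g, h, a, b⟩)
    · simp [h₁]
    · simp [← h₂])

variable {φ} in
theorem toGroup_gen {M : Type w} [Group M] (f : G → Γ → M) (h₁ h₂) (g : G) (a : Γ) :
    toGroup (φ := φ) f h₁ h₂ (gen φ g a) = f g a :=
  PresentedGroup.toGroup.of _

variable {φ} in
theorem hom_ext {M : Type w} [Group M] {α β : NormalClosure φ →* M}
    (h : ∀ g a, α (gen φ g a) = β (gen φ g a)) : α = β :=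
  PresentedGroup.ext fun x => h x.1 x.2

/-- The canonical map `Γ → Γ^φ`. -/
def unit : Γ →* NormalClosure φ := MonoidHom.mk' (gen φ 1) (gen_mul φ 1)

/-- The canonical map `Γ^φ → G`, `(g, a) ↦ g φ(a) g⁻¹`. -/
def counit : NormalClosure φ →* G :=
  toGroup (fun g a => g * φ a * g⁻¹) (fun g a b => by rw [map_mul]; group)
    (fun g h a b => by group)

theorem counit_gen (g : G) (a : Γ) : counit φ (gen φ g a) = g * φ a * g⁻¹ :=
  toGroup_gen _ _ _ _ _

theorem counit_unit (a : Γ) : counit φ (unit φ a) = φ a :=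
  (counit_gen φ 1 a).trans (by simp)

/-- Translation by `h`, `(g, a) ↦ (h g, a)`. -/
def translate (h : G) : NormalClosure φ →* NormalClosure φ :=
  toGroup (fun g a => gen φ (h * g) a) (fun _ _ _ => gen_mul φ _ _ _)
    (fun g k a b => by rw [gen_conj]; congr 1; group)

theorem translate_gen (h g : G) (a : Γ) : translate φ h (gen φ g a) = gen φ (h * g) a :=
  toGroup_gen _ _ _ _ _

theorem translate_one : translate φ 1 = MonoidHom.id _ :=
  hom_ext fun g a => by simp [translate_gen]

theorem translate_comp (h k : G) :
    (translate φ h).comp (translate φ k) = translate φ (h * k) :=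
  hom_ext fun g a => by simp [translate_gen, mul_assoc]

/-- The action of `G` on the free normal closure. -/
def act : G →* MulAut (NormalClosure φ) :=
  MonoidHom.mk' (fun h => (translate φ h).toMulEquiv (translate φ h⁻¹)
      (by rw [translate_comp, inv_mul_cancel, translate_one])
      (by rw [translate_comp, mul_inv_cancel, translate_one]))
    (fun h k => by
      ext x
      exact (DFunLike.congr_fun (translate_comp φ h k) x).symm)

theorem act_gen (h g : G) (a : Γ) : act φ h (gen φ g a) = gen φ (h * g) a :=
  translate_gen φ h g a

theorem peiffer_aux (m : NormalClosure φ) : (act φ (counit φ m)).toMonoidHom =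
    (MulAut.conj m).toMonoidHom := by
  have key : (act φ).comp (counit φ) = MulAut.conj := by
    refine hom_ext fun g a => ?_
    have : (act φ (counit φ (gen φ g a))).toMonoidHom =
        (MulAut.conj (gen φ g a)).toMonoidHom := by
      refine hom_ext fun h b => ?_
      change act φ _ (gen φ h b) = gen φ g a * gen φ h b * (gen φ g a)⁻¹
      rw [act_gen, gen_conj, counit_gen]
    exact MulEquiv.ext fun x => DFunLike.congr_fun this x
  exact congrArg MulEquiv.toMonoidHom (DFunLike.congr_fun key m)

/-- The free normal closure as a normal map `Γ^φ → G`. -/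
def normalMap : NormalMap (NormalClosure φ) G where
  hom := counit φ
  act := act φ
  hom_act g m := by
    have : (counit φ).comp (act φ g).toMonoidHom =
        (MulAut.conj g).toMonoidHom.comp (counit φ) := by
      refine hom_ext fun h a => ?_
      change counit φ (act φ g (gen φ h a)) = g * counit φ (gen φ h a) * g⁻¹
      rw [act_gen, counit_gen, counit_gen]; group
    exact DFunLike.congr_fun this m
  peiffer m m' := DFunLike.congr_fun (peiffer_aux φ m) m'

/-- The universal property: `Γ → Γ^φ → G` is initial among the factorizations of `φ` as a
homomorphism `ψ : Γ → M` followed by a normal map `n : M → G`; morphisms are the homomorphisms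
over `G` that respect the actions of `G`. -/
theorem existsUnique_lift {M : Type w} [Group M] (n : NormalMap M G) (ψ : Γ →* M)
    (hψ : ∀ a, n.hom (ψ a) = φ a) :
    ∃! θ : NormalClosure φ →* M, (∀ a, θ (unit φ a) = ψ a) ∧
      (∀ x, n.hom (θ x) = (normalMap φ).hom x) ∧
      ∀ g x, θ ((normalMap φ).act g x) = n.act g (θ x) := by
  let θ : NormalClosure φ →* M := toGroup (fun g a => n.act g (ψ a))
    (fun g a b => by simp) (fun g h a b => by
      rw [← n.peiffer, n.hom_act, hψ, ← MulAut.mul_apply, ← map_mul])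
  have hθ : ∀ g a, θ (gen φ g a) = n.act g (ψ a) := toGroup_gen _ _ _
  refine ⟨θ, ⟨fun a => (hθ 1 a).trans (by simp), fun x => ?_, fun g x => ?_⟩, ?_⟩
  · have : n.hom.comp θ = counit φ := hom_ext fun g a => by
      rw [MonoidHom.comp_apply, hθ, n.hom_act, hψ, counit_gen]
    exact DFunLike.congr_fun this x
  · have : θ.comp (act φ g).toMonoidHom = (n.act g).toMonoidHom.comp θ := by
      refine hom_ext fun h a => ?_
      change θ (act φ g (gen φ h a)) = n.act g (θ (gen φ h a))
      rw [act_gen, hθ, hθ, map_mul, MulAut.mul_apply]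
    exact DFunLike.congr_fun this x
  · rintro θ' ⟨h₁, -, h₃⟩
    refine hom_ext fun g a => ?_
    have h := h₃ g (unit φ a)
    rw [h₁] at h
    rw [hθ, ← h]
    change _ = θ' (act φ g (gen φ 1 a))
    rw [act_gen, mul_one]

end NormalClosure

end NormalClosure

/-- A group together with a homomorphism from `Γ`. -/
structure GroupUnder (Γ : Type u) [Group Γ] : Type (u + 1) where
  carrier : Type u
  [group : Group carrier]
  hom : Γ →* carrier

attribute [instance] GroupUnder.group

section Tower

variable {Γ G : Type u} [Group Γ] [Group G]

/-- The normal closures tower of `φ`, indexed from `0`: `stage φ i` is the group `Γ_{i+1,φ}`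
together with `φ_{i+1} : Γ → Γ_{i+1,φ}`. -/
def stage (φ : Γ →* G) : ℕ → GroupUnder Γ
  | 0 => ⟨G, φ⟩
  | i + 1 => ⟨NormalClosure (stage φ i).hom, NormalClosure.unit (stage φ i).hom⟩

/-- The group `Γ_{i+1,φ}`. -/
abbrev Tower (φ : Γ →* G) (i : ℕ) : Type u := (stage φ i).carrier

/-- The map `φ_{i+1} : Γ → Γ_{i+1,φ}`. -/
abbrev towerMap (φ : Γ →* G) (i : ℕ) : Γ →* Tower φ i := (stage φ i).hom

/-- The structure map from each group of the tower to the preceding one. -/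
def step (φ : Γ →* G) (i : ℕ) : Tower φ (i + 1) →* Tower φ i :=
  NormalClosure.counit (towerMap φ i)

/-- The tower is constant from index `t` on: its structure maps are isomorphisms from there on. -/
def TerminatesAt (φ : Γ →* G) (t : ℕ) : Prop :=
  ∀ i, t ≤ i → Function.Bijective (step φ i)

/-- The inverse limit `Γ_{∞,φ}` of the normal closures tower. -/
def limit (φ : Γ →* G) : Subgroup ((i : ℕ) → Tower φ i) where
  carrier := {x | ∀ i, step φ i (x (i + 1)) = x i}
  mul_mem' {x y} hx hy i := by simp [hx i, hy i]
  one_mem' i := by simp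
  inv_mem' {x} hx i := by simp [hx i]

/-- The projection of the inverse limit to a member of the tower. -/
def proj (φ : Γ →* G) (i : ℕ) : limit φ →* Tower φ i :=
  (Pi.evalMonoidHom (Tower φ) i).comp (limit φ).subtype

/-- The map `Γ_{∞,φ} → G`. -/
def toBase (φ : Γ →* G) : limit φ →* G := proj φ 0

/-- The map `φ_∞ : Γ → Γ_{∞,φ}`. -/
def toLimit (φ : Γ →* G) : Γ →* limit φ :=
  (MonoidHom.mk' (fun a i => towerMap φ i a) (fun a b => by ext i; simp)).codRestrict (limit φ)
    (fun a i => NormalClosure.counit_unit (towerMap φ i) a)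

end Tower

section Series

variable {Γ : Type u} {G : Type v} [Group Γ] [Group G]

/-- The series of successive normal closures of `H` in `G`: `C₀ = G`, `C_{i+1} = ⟨H^{C_i}⟩`. -/
def closureSeries (H : Subgroup G) : ℕ → Subgroup G
  | 0 => ⊤
  | i + 1 => Subgroup.closure {x | ∃ c ∈ closureSeries H i, ∃ h ∈ H, x = c * h * c⁻¹}

/-- The intersection of the series of successive normal closures of `φ(Γ)` in `G`; it is the
terminal member of the series whenever the series terminates. -/
def subnormalClosure (φ : Γ →* G) : Subgroup G := ⨅ i, closureSeries φ.range i

theorem mem_subnormalClosure (φ : Γ →* G) (a : Γ) : φ a ∈ subnormalClosure φ := by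
  refine Subgroup.mem_iInf.2 fun i => ?_
  cases i with
  | zero => exact Subgroup.mem_top _
  | succ i =>
    exact Subgroup.subset_closure ⟨1, one_mem _, φ a, ⟨a, rfl⟩, by simp⟩

/-- The series of successive commutators of `K = ker φ` with `Γ`, indexed from `0`:
`kerSeries φ i` is `K_{i+1}`, where `K₁ = K` and `K_{i+1} = [Γ, K_i]`. -/
def kerSeries (φ : Γ →* G) : ℕ → Subgroup Γ
  | 0 => φ.ker
  | i + 1 => ⁅(⊤ : Subgroup Γ), kerSeries φ i⁆

theorem kerSeries_normal (φ : Γ →* G) (i : ℕ) : (kerSeries φ i).Normal := by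
  induction i with
  | zero => exact MonoidHom.normal_ker φ
  | succ i ih => exact Subgroup.commutator_normal _ _

/-- The intersection of the series of successive commutators of `ker φ` with `Γ`; it is the
terminal member of the series whenever the series terminates. -/
def kerTerminal (φ : Γ →* G) : Subgroup Γ := ⨅ i, kerSeries φ i

instance kerTerminal_normal (φ : Γ →* G) : (kerTerminal φ).Normal :=
  Subgroup.normal_iInf_normal (kerSeries_normal φ)

/-- The map `Γ → 𝒞` induced by `φ`. -/
def inducedRho (φ : Γ →* G) : Γ →* subnormalClosure φ :=
  φ.codRestrict _ (mem_subnormalClosure φ)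

/-- The map `Γ/𝒦 → 𝒞` induced by `φ`. -/
def inducedPsi (φ : Γ →* G) : Γ ⧸ kerTerminal φ →* subnormalClosure φ :=
  QuotientGroup.lift (kerTerminal φ) (inducedRho φ) (fun a ha => by
    have h : a ∈ φ.ker := Subgroup.mem_iInf.1 ha 0
    exact Subtype.ext h)

end Series

/-- `g(1) = 1`, and `g(t) = t ^ ((log_p t + 1) / 2)` for `t ≥ 2` with least prime divisor `p`. -/
def sizeBound (t : ℕ) : ℝ :=
  if t ≤ 1 then 1 else (t : ℝ) ^ ((Real.logb (t.minFac : ℝ) (t : ℝ) + 1) / 2)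

end SubnormalTower

end

/-! An element `x` of a free normal closure acts on it through `counit φ x`, and by the Peiffer
identity this is conjugation by `x`. Hence every structure map of a tower has central kernel
(`NormalClosure.ker_counit_le_center`), and everything follows from this and from functoriality.

The tower of `φ` reaches `G` through smaller and smaller members of the closure series, so some
member maps to `𝒞`. This gives maps between the towers of `φ` and `ρ` in both directions, up to a
shift, whose composites are structure maps; the limits therefore agree (`limitEquiv`). An element of
`Γ` killed at one stage goes to a central element at the next, so its commutators with `Γ` die
there. Thus `𝒦` dies at every stage of the tower of `ρ` and can be divided out.

Since `𝒞` is the normal closure of its subgroup `ρ(Γ)`, each stage `M` of that tower is a finite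
hypercentral extension of `𝒞`, normally generated by `Γ`. Let `N` be the nilpotent residual of `M`
and `Z` the kernel of `M → 𝒞`. The nilpotent quotient `M/N` is an image of `Γ/𝒦`, and `|N| ≤ |𝒞| |N
∩ Z|`. For a prime `q`, a `q`-subgroup of `N ∩ Z` is central in the subgroup `R` generated by the
`q'`-elements, so by transfer it lies in the derived subgroup of a Sylow `q`-subgroup of `R`. If
`q^n` is the `q`-part of `|𝒞|`, that derived subgroup has order at most `q^(n choose 2)`. The
resulting bound is uniform over the stages, so the surjections of the tower are eventually
isomorphisms. -/

noncomputable section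

namespace SubnormalTower

/-! ### Hypercentral elements, derived subgroups of `p`-groups and transfer -/

section HypercentralExtensions

open Subgroup hiding commutator
open scoped commutatorElement

/-- Elements of coprime orders commute if one of them lies in the hypercenter. -/
theorem commute_of_mem_upperCentralSeries {n : ℕ} {M : Type u} [Group M] {w x : M}
    (hw : w ∈ Subgroup.upperCentralSeries M n) (h : (orderOf w).Coprime (orderOf x)) :
    Commute w x := by
  induction n generalizing M with
  | zero =>
    rw [Subgroup.upperCentralSeries_zero, mem_bot] at hw
    exact hw ▸ Commute.one_left x
  | succ n ih =>
    have hw' : (w : M ⧸ center M) ∈ Subgroup.upperCentralSeries (M ⧸ center M) n := by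
      rw [← Subgroup.comap_upperCentralSeries_quotient_center] at hw
      exact hw
    have hc := ih (w := (w : M ⧸ center M)) (x := (x : M ⧸ center M)) hw'
      (Nat.Coprime.of_dvd (orderOf_map_dvd (QuotientGroup.mk' _) w)
        (orderOf_map_dvd (QuotientGroup.mk' _) x) h)
    have hz : w * x * w⁻¹ * x⁻¹ ∈ center M := by
      rw [← QuotientGroup.eq_one_iff]
      simp only [QuotientGroup.mk_mul, QuotientGroup.mk_inv]
      rw [hc.eq]
      group
    set c := w * x * w⁻¹ * x⁻¹ with hcdef
    have hcx : w * x * w⁻¹ = c * x := by simp [hcdef]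
    have hcw : x * w * x⁻¹ = c⁻¹ * w := by simp [hcdef, mul_assoc]
    -- `c * x` is conjugate to `x` and `c` is central, so the power `orderOf x` leaves only `c ^
    -- orderOf x`; `h₂` is the same with `w`.
    have h₁ : c ^ orderOf x = 1 := by
      have : (w * x * w⁻¹) ^ orderOf x = 1 := by rw [conj_pow, pow_orderOf_eq_one]; simp
      rwa [hcx, Commute.mul_pow (mem_center_iff.1 hz x).symm, pow_orderOf_eq_one,
        mul_one] at this
    have h₂ : c ^ orderOf w = 1 := by
      have : (x * w * x⁻¹) ^ orderOf w = 1 := by rw [conj_pow, pow_orderOf_eq_one]; simp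
      rwa [hcw, (show Commute c w from (mem_center_iff.1 hz w).symm).inv_left.mul_pow,
        pow_orderOf_eq_one, mul_one, inv_pow, inv_eq_one] at this
    have h₃ : c = 1 := by
      have := Nat.dvd_gcd (orderOf_dvd_of_pow_eq_one h₂) (orderOf_dvd_of_pow_eq_one h₁)
      rwa [h.gcd_eq_one, Nat.dvd_one, orderOf_eq_one_iff] at this
    rw [h₃, one_mul] at hcx
    exact mul_inv_eq_iff_eq_mul.1 hcx

/-- If `x` is central modulo a central subgroup, then `s ↦ ⁅s, x⁆` is a homomorphism. -/
def commutatorHom {S : Type u} [Group S] (x : S) (hx : ∀ s : S, ⁅s, x⁆ ∈ center S) : S →* S :=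
  MonoidHom.mk' (fun s => ⁅s, x⁆) fun a b => by
    have h : b * x * b⁻¹ = ⁅b, x⁆ * x := by simp [commutatorElement_def]
    have hb := mem_center_iff.1 (hx b)
    calc ⁅a * b, x⁆ = a * (b * x * b⁻¹) * a⁻¹ * x⁻¹ := by simp [commutatorElement_def, mul_assoc]
      _ = (a * ⁅b, x⁆) * x * a⁻¹ * x⁻¹ := by rw [h]; simp only [mul_assoc]
      _ = ⁅b, x⁆ * ⁅a, x⁆ := by rw [hb a, commutatorElement_def a x]; simp only [mul_assoc]
      _ = ⁅a, x⁆ * ⁅b, x⁆ := (hb _).symm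

/-- A bound for the derived subgroup of a finite `p`-group in terms of the index of a central
subgroup. -/
theorem card_commutator_dvd_of_index_dvd {p : ℕ} [Fact p.Prime] (n : ℕ) {S : Type u} [Group S]
    [Finite S] (hS : IsPGroup p S) (A : Subgroup S) (hA : A ≤ center S)
    (hn : A.index ∣ p ^ n) : Nat.card (commutator S) ∣ p ^ n.choose 2 := by
  induction n generalizing S with
  | zero =>
    rw [pow_zero, Nat.dvd_one, index_eq_one] at hn
    have : commutator S = ⊥ := by
      rw [_root_.commutator_def, commutator_eq_bot_iff_le_centralizer]
      rw [hn] at hA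
      exact hA.trans (center_le_centralizer _)
    simp [this]
  | succ n ih =>
    have hAn : A.Normal := ⟨fun a ha g => by
      rwa [mem_center_iff.1 (hA ha) g, mul_inv_cancel_right]⟩
    -- The index only divides `p ^ (n + 1)`, so it may be `1`; otherwise `S ⧸ A` has a nontrivial
    -- central element.
    by_cases hT : A = ⊤
    · exact (ih hS A hA (by simp [hT])).trans
        (pow_dvd_pow p (Nat.choose_le_choose 2 n.le_succ))
    have : Nontrivial (S ⧸ A) := QuotientGroup.nontrivial_iff.2 hT
    have := (hS.to_quotient A).center_nontrivial
    obtain ⟨⟨y, hy⟩, hy1⟩ := exists_ne (1 : center (S ⧸ A))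
    obtain ⟨x, rfl⟩ := QuotientGroup.mk_surjective y
    have hxA : x ∉ A := fun h => hy1 (Subtype.ext ((QuotientGroup.eq_one_iff x).2 h))
    have hx : ∀ s, ⁅s, x⁆ ∈ A := fun s => by
      rw [← QuotientGroup.eq_one_iff, commutatorElement_def]
      simp only [QuotientGroup.mk_mul, QuotientGroup.mk_inv]
      rw [mem_center_iff.1 hy s]
      group
    let f := commutatorHom x fun s => hA (hx s)
    have hf : ∀ s, f s = ⁅s, x⁆ := fun _ => rfl
    -- `D` is strictly larger than `A` and is killed by `f`, so the order of `f.range` divides `p ^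
    -- n`.
    let D := A ⊔ zpowers x
    have hD : D ≤ f.ker := by
      refine sup_le (fun a ha => ?_) ((zpowers_le).2 ?_)
      · rw [MonoidHom.mem_ker, hf, commutatorElement_eq_one_iff_mul_comm]
        exact (mem_center_iff.1 (hA ha) x).symm
      · rw [MonoidHom.mem_ker, hf, commutatorElement_self]
    have hDn : D.index ∣ p ^ n := by
      have h1 : A.relIndex D * D.index = A.index := relIndex_mul_index le_sup_left
      have h2 : D.index ∣ p ^ (n + 1) := (Dvd.intro_left _ h1).trans hn
      obtain ⟨m, hm, hm'⟩ := (Nat.dvd_prime_pow Fact.out).1 h2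
      obtain ⟨k, hk, hk'⟩ := (Nat.dvd_prime_pow Fact.out).1 hn
      have hlt : D.index ≠ A.index := fun h => by
        rw [h, Nat.mul_eq_right (index_ne_zero_of_finite), relIndex_eq_one] at h1
        exact hxA (h1 (mem_sup_right (mem_zpowers x)))
      rw [hm'] at hlt ⊢
      have h3 : p ^ m ∣ p ^ k := by rw [← hm', ← hk']; exact Dvd.intro_left _ h1
      rw [hk'] at hlt
      have := (Nat.pow_dvd_pow_iff_le_right (Fact.out : p.Prime).one_lt).1 h3
      have : m ≠ k := fun h => hlt (by rw [h])
      exact pow_dvd_pow p (by omega)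
    let B := f.range
    have hBA : B ≤ A := by rintro _ ⟨s, rfl⟩; exact hx s
    have hBn : B.Normal := ⟨fun a ha g => by
      rwa [mem_center_iff.1 (hA (hBA ha)) g, mul_inv_cancel_right]⟩
    have hB : Nat.card B ∣ p ^ n := by
      rw [← index_ker]
      exact (index_dvd_of_le hD).trans hDn
    have hBc : B ≤ commutator S := by
      rintro _ ⟨s, rfl⟩
      exact commutator_mem_commutator (mem_top _) (mem_top _)
    let π := QuotientGroup.mk' B
    have hπ : Function.Surjective π := QuotientGroup.mk'_surjective B
    -- Dividing by all the `⁅s, x⁆` makes `x` central, so induction applies to `S ⧸ B` and the image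
    -- of `D`.
    have hDc : D.map π ≤ center (S ⧸ B) := by
      rw [Subgroup.map_sup, sup_le_iff]
      constructor
      · rintro _ ⟨a, ha, rfl⟩
        refine mem_center_iff.2 fun g => ?_
        obtain ⟨g, rfl⟩ := hπ g
        rw [← map_mul, ← map_mul, mem_center_iff.1 (hA ha) g]
      · rw [MonoidHom.map_zpowers, zpowers_le]
        refine mem_center_iff.2 fun g => ?_
        obtain ⟨g, rfl⟩ := hπ g
        rw [← commutatorElement_eq_one_iff_mul_comm, ← map_commutatorElement]
        exact (QuotientGroup.eq_one_iff _).2 ⟨g, rfl⟩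
    have key := ih (hS.to_quotient B) (D.map π) hDc ((index_map_dvd D hπ).trans hDn)
    have hmap : (commutator S).map π = commutator (S ⧸ B) := by
      rw [_root_.commutator_def, _root_.commutator_def, map_commutator, ← MonoidHom.range_eq_map,
        MonoidHom.range_eq_top.2 hπ]
    have hcard : Nat.card (commutator S) = Nat.card (commutator (S ⧸ B)) * Nat.card B := by
      have h := relIndex_mul_relIndex ⊥ B (commutator S) bot_le hBc
      rw [relIndex_bot_left, relIndex_bot_left, ← QuotientGroup.ker_mk' B, relIndex_ker, hmap,
        QuotientGroup.ker_mk'] at h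
      rw [← h, mul_comm]
    rw [hcard, Nat.choose_succ_succ' n 1, Nat.choose_one_right, pow_add, mul_comm]
    exact mul_dvd_mul hB key

/-- In a finite group generated by `q'`-elements, the central elements of a Sylow `q`-subgroup lie in
its derived subgroup, by transfer. -/
theorem mem_commutator_of_mem_center {q : ℕ} [Fact q.Prime] {R : Type u} [Group R] [Finite R]
    (hR : closure {x : R | (orderOf x).Coprime q} = ⊤) (P : Sylow q R) (w : P)
    (hw : (w : R) ∈ center R) : w ∈ commutator P := by
  let f : R →* Abelianization P := MonoidHom.transfer (Abelianization.of (G := P))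
  -- The target is a `q`-group, so the transfer kills the generating `q'`-elements.
  have hf : f = 1 := by
    refine MonoidHom.eq_of_eqOn_dense hR fun x hx => ?_
    obtain ⟨k, hk⟩ := (P.2.of_surjective (Abelianization.of (G := P))
      QuotientGroup.mk_surjective) (f x)
    have h := Nat.dvd_gcd (orderOf_map_dvd f x) (orderOf_dvd_of_pow_eq_one hk)
    rw [(Nat.Coprime.pow_right k hx : Nat.gcd _ _ = 1), Nat.dvd_one, orderOf_eq_one_iff] at h
    exact h
  -- On a central element the transfer is the power by the index, which is prime to `q`.
  have hpow : w ^ (P : Subgroup R).index ∈ commutator P := by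
    have h := MonoidHom.transfer_eq_pow (Abelianization.of (G := P)) (w : R)
      fun k g _ => by
        rw [mem_center_iff.1 (pow_mem hw k) g⁻¹, inv_mul_cancel_right]
    change f w = _ at h
    rw [hf, MonoidHom.one_apply, eq_comm, ← MonoidHom.mem_ker, Abelianization.ker_of] at h
    exact h
  obtain ⟨k, hk⟩ := P.2 w
  have hcop : (q ^ k).Coprime (P : Subgroup R).index := Nat.Coprime.pow_left k
    ((Nat.Prime.coprime_iff_not_dvd Fact.out).2 P.not_dvd_index)
  have hw1 : w ^ ((q ^ k).gcd (P : Subgroup R).index) ∈ commutator P := by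
    rw [← zpow_natCast, Nat.gcd_eq_gcd_ab, zpow_add, zpow_mul, zpow_mul, zpow_natCast,
      zpow_natCast, hk]
    simpa using zpow_mem hpow _
  rwa [hcop.gcd_eq_one, pow_one] at hw1

end HypercentralExtensions

/-! ### Orders of finite hypercentral extensions -/

section HypercentralBound

open Subgroup hiding commutator

theorem coprime_orderOf_of_mem_isPGroup {q : ℕ} {R : Type u} [Group R] {W : Subgroup R}
    (hW : IsPGroup q W) {w x : R} (hw : w ∈ W) (hx : (orderOf x).Coprime q) :
    (orderOf w).Coprime (orderOf x) := by
  obtain ⟨k, hk⟩ := hW ⟨w, hw⟩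
  have : orderOf w ∣ q ^ k := orderOf_dvd_of_pow_eq_one (congrArg Subtype.val hk)
  exact (hx.symm.pow_left k).coprime_dvd_left this

/-- In a finite group generated by `q'`-elements, the order of a `q`-subgroup of a normal subgroup
`Z` all of whose `q`-elements commute with all `q'`-elements is bounded in terms of the index
of `Z`. -/
theorem card_dvd_of_isPGroup_of_le {q : ℕ} [Fact q.Prime] {R : Type u} [Group R] [Finite R]
    (hR : closure {x : R | (orderOf x).Coprime q} = ⊤) (Z : Subgroup R) [Z.Normal]
    (hZ : ∀ w ∈ Z, ∀ x, (orderOf w).Coprime (orderOf x) → Commute w x) {W : Subgroup R}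
    (hW : IsPGroup q W) (hWZ : W ≤ Z) {n : ℕ} (hn : Z.index ∣ n) (hn0 : n ≠ 0) :
    Nat.card W ∣ q ^ (n.factorization q).choose 2 := by
  have hcen : ∀ w ∈ Z, (∀ x : R, (orderOf x).Coprime q → (orderOf w).Coprime (orderOf x)) →
      w ∈ center R := fun w hw h => by
    have hle : closure {x : R | (orderOf x).Coprime q} ≤ centralizer {w} :=
      (closure_le _).2 fun x hx => mem_centralizer_singleton_iff.2 (hZ w hw x (h x hx)).eq.symm
    rw [hR] at hle
    exact mem_center_iff.2 fun x => mem_centralizer_singleton_iff.1 (hle (mem_top x))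
  obtain ⟨P, hP⟩ := hW.exists_le_sylow
  have hA : Z.subgroupOf P ≤ center P := fun w hw => mem_center_iff.2 fun x => Subtype.ext
    (mem_center_iff.1 (hcen w hw fun x hx => coprime_orderOf_of_mem_isPGroup P.2 w.2 hx) x)
  -- This index is a power of `q` and divides the index of the normal subgroup `Z`.
  have hindex : (Z.subgroupOf (P : Subgroup R)).index ∣ q ^ n.factorization q := by
    obtain ⟨k, hk⟩ := P.2.index (Z.subgroupOf (P : Subgroup R))
    rw [hk]
    refine pow_dvd_pow q ((Nat.Prime.pow_dvd_iff_le_factorization Fact.out hn0).1 ?_)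
    rw [← hk]
    exact (relIndex_dvd_index_of_normal Z (P : Subgroup R)).trans hn
  have hcomm := card_commutator_dvd_of_index_dvd (n.factorization q) P.2 _ hA hindex
  refine dvd_trans ?_ hcomm
  have hle : W.subgroupOf (P : Subgroup R) ≤ commutator P := fun w hw =>
    mem_commutator_of_mem_center hR P w
      (hcen w (hWZ hw) fun x hx => coprime_orderOf_of_mem_isPGroup P.2 w.2 hx)
  rw [← Nat.card_congr (subgroupOfEquivOfLe hP).toEquiv]
  exact card_dvd_of_le hle

/-- The subgroup generated by the elements of order prime to `q`. -/
def primeResidual (q : ℕ) (M : Type u) [Group M] : Subgroup M :=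
  closure {x : M | (orderOf x).Coprime q}

instance primeResidual_normal (q : ℕ) (M : Type u) [Group M] : (primeResidual q M).Normal := by
  refine ⟨fun x hx g => ?_⟩
  have h : (primeResidual q M).map (MulAut.conj g).toMonoidHom ≤ primeResidual q M := by
    rw [primeResidual, MonoidHom.map_closure, closure_le]
    rintro _ ⟨x, hx, rfl⟩
    refine subset_closure ?_
    change (orderOf (MulAut.conj g x)).Coprime q
    rwa [MulEquiv.orderOf_eq]
  exact h ⟨x, hx, rfl⟩

theorem isPGroup_quotient_primeResidual (q : ℕ) [Fact q.Prime] (M : Type u) [Group M] [Finite M] :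
    IsPGroup q (M ⧸ primeResidual q M) := by
  intro g
  obtain ⟨g, rfl⟩ := QuotientGroup.mk_surjective g
  refine ⟨(orderOf g).factorization q, ?_⟩
  rw [← QuotientGroup.mk_pow, QuotientGroup.eq_one_iff]
  refine subset_closure ?_
  have h0 : orderOf g ≠ 0 := (orderOf_pos g).ne'
  change (orderOf _).Coprime q
  rw [orderOf_pow_of_dvd (pow_ne_zero _ (Fact.out : q.Prime).ne_zero) (Nat.ordProj_dvd _ _)]
  exact (Nat.coprime_ordCompl Fact.out h0).symm

theorem closure_coprime_primeResidual (q : ℕ) (M : Type u) [Group M] :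
    closure {x : primeResidual q M | (orderOf x).Coprime q} = ⊤ := by
  have h : {x : primeResidual q M | (orderOf x).Coprime q} =
      ((↑) : primeResidual q M → M) ⁻¹' {x : M | (orderOf x).Coprime q} := by
    ext x
    simp
  rw [h]
  exact closure_closure_coe_preimage

theorem lowerCentralSeries_le_of_isNilpotent_quotient {M : Type u} [Group M] (R : Subgroup M)
    [R.Normal] [Group.IsNilpotent (M ⧸ R)] : ∃ m, (⊤ : Subgroup M).lowerCentralSeries m ≤ R := by
  obtain ⟨m, hm⟩ := Subgroup.nilpotent_iff_lowerCentralSeries.1 ‹Group.IsNilpotent (M ⧸ R)›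
  refine ⟨m, ?_⟩
  have h := map_lowerCentralSeries (⊤ : Subgroup M) (QuotientGroup.mk' R) m
  rw [← MonoidHom.range_eq_map, QuotientGroup.range_mk', hm, Subgroup.map_eq_bot_iff,
    QuotientGroup.ker_mk'] at h
  exact h

/-- A homomorphism to a finite nilpotent group is surjective if its image generates the group as a
normal subgroup. -/
theorem surjective_of_normalClosure_eq_top {Γ : Type v} {Q : Type u} [Group Γ] [Group Q] [Finite Q]
    [Group.IsNilpotent Q] (f : Γ →* Q) (hf : normalClosure (Set.range f) = ⊤) :
    Function.Surjective f := by
  rw [← MonoidHom.range_eq_top]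
  -- A proper image lies in a maximal subgroup, which is normal because the group is nilpotent.
  by_contra h
  obtain ⟨K, hK, hle⟩ := (eq_top_or_exists_le_coatom f.range).resolve_left h
  have : K.Normal := NormalizerCondition.normal_of_coatom K Group.normalizerCondition_of_isNilpotent hK
  exact hK.1 (top_le_iff.1 (hf ▸ normalClosure_le_normal hle))

/-- If `q^n` is the `q`-part of `t`, then `q^n * q^(n choose 2) = (q^n)^((n+1)/2)`, and `n ≤ log_p
t` because `p^n ≤ q^n ≤ t`. The product over the primes `q` dividing `t` gives the bound. -/
theorem mul_le_sizeBound {t y : ℕ} (ht : t ≠ 0) (hy : y ≠ 0)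
    (h : ∀ q, q.Prime → y.factorization q ≤ (t.factorization q).choose 2) :
    ((t * y : ℕ) : ℝ) ≤ sizeBound t := by
  have hsub : y.primeFactors ⊆ t.primeFactors := fun q hq => by
    have hq' := Nat.prime_of_mem_primeFactors hq
    have h1 := (Nat.prime_of_mem_primeFactors hq).factorization_pos_of_dvd hy
      (Nat.dvd_of_mem_primeFactors hq)
    have h2 := h q hq'
    rw [← Nat.support_factorization, Finsupp.mem_support_iff]
    intro h0
    simp only [h0, Nat.choose_zero_succ] at h2
    omega
  have hprod : ∀ m : ℕ, m ≠ 0 → m.primeFactors ⊆ t.primeFactors →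
      ∏ q ∈ t.primeFactors, (q : ℝ) ^ m.factorization q = m := fun m hm hms => by
    conv_rhs => rw [← Nat.prod_factorization_pow_eq_self hm]
    push_cast
    symm
    refine Finset.prod_subset hms fun q _ hq => ?_
    simp [Finsupp.notMem_support_iff.1 hq]
  rw [sizeBound]
  split_ifs with ht1
  · obtain rfl : t = 1 := by omega
    have : y.primeFactors = ∅ := by simpa using hsub
    rw [Nat.primeFactors_eq_empty] at this
    have : y = 1 := by omega
    simp [this]
  set s : ℝ := (Real.logb (t.minFac : ℝ) (t : ℝ) + 1) / 2 with hs
  have hp : t.minFac.Prime := Nat.minFac_prime (by omega)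
  have hle : ∀ q ∈ t.primeFactors, (q : ℝ) ^ t.factorization q * (q : ℝ) ^ y.factorization q ≤
      ((q : ℝ) ^ t.factorization q) ^ s := fun q hq => by
    have hq' := Nat.prime_of_mem_primeFactors hq
    have hq1 : (1 : ℝ) ≤ q := by exact_mod_cast hq'.one_le
    set n := t.factorization q
    have hn : (n : ℝ) ≤ Real.logb t.minFac t := by
      rw [Real.le_logb_iff_rpow_le (by exact_mod_cast hp.one_lt) (by positivity),
        Real.rpow_natCast]
      have h1 : t.minFac ^ n ≤ q ^ n := Nat.pow_le_pow_left
        (Nat.minFac_le_of_dvd hq'.two_le (Nat.dvd_of_mem_primeFactors hq)) n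
      exact_mod_cast h1.trans (Nat.le_of_dvd (Nat.pos_of_ne_zero ht) (Nat.ordProj_dvd t q))
    rw [← pow_add, ← Real.rpow_natCast, ← Real.rpow_natCast, ← Real.rpow_mul (by linarith)]
    refine Real.rpow_le_rpow_of_exponent_le hq1 ?_
    have h2 : (y.factorization q : ℝ) ≤ n * (n - 1) / 2 := by
      rw [← Nat.cast_choose_two]
      exact_mod_cast h q hq'
    push_cast
    rw [hs]
    nlinarith [n.cast_nonneg (α := ℝ)]
  calc ((t * y : ℕ) : ℝ)
      = ∏ q ∈ t.primeFactors, (q : ℝ) ^ t.factorization q * (q : ℝ) ^ y.factorization q := by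
        rw [Finset.prod_mul_distrib, hprod t ht subset_rfl, hprod y hy hsub, Nat.cast_mul]
    _ ≤ ∏ q ∈ t.primeFactors, ((q : ℝ) ^ t.factorization q) ^ s :=
        Finset.prod_le_prod (fun q _ => by positivity) hle
    _ = (t : ℝ) ^ s := by
        rw [Real.finsetProd_rpow _ _ (fun q _ => by positivity), hprod t ht subset_rfl]

/-- The nilpotent residual meets a hypercentral normal subgroup `Z` in a subgroup whose order is
bounded in terms of the index of `Z`. -/
theorem factorization_card_inf_le {M : Type u} [Group M] [Finite M] (Z N : Subgroup M) [Z.Normal]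
    {n : ℕ} (hZ : Z ≤ Subgroup.upperCentralSeries M n)
    (hN : ∀ m, N ≤ (⊤ : Subgroup M).lowerCentralSeries m) {q : ℕ} (hq : q.Prime) :
    (Nat.card (N ⊓ Z : Subgroup M)).factorization q ≤ (Z.index.factorization q).choose 2 := by
  have : Fact q.Prime := ⟨hq⟩
  let R := primeResidual q M
  have hNR : N ≤ R := by
    have := (isPGroup_quotient_primeResidual q M).isNilpotent
    obtain ⟨m, hm⟩ := lowerCentralSeries_le_of_isNilpotent_quotient R
    exact (hN m).trans hm
  let Y := N ⊓ Z
  obtain ⟨Q⟩ : Nonempty (Sylow q Y) := inferInstance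
  let W : Subgroup M := (Q : Subgroup Y).map Y.subtype
  have hWY : W ≤ Y := map_subtype_le _
  have hWR : W ≤ R := hWY.trans (inf_le_left.trans hNR)
  have hcardW : Nat.card (W.subgroupOf R) = q ^ (Nat.card Y).factorization q := by
    rw [Nat.card_congr (subgroupOfEquivOfLe hWR).toEquiv, ← Q.card_eq_multiplicity]
    exact Nat.card_congr ((Q : Subgroup Y).equivMapOfInjective _ Y.subtype_injective).symm.toEquiv
  have key := card_dvd_of_isPGroup_of_le (closure_coprime_primeResidual q M) (Z.subgroupOf R)
    (fun w hw x hwx => by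
      have h := commute_of_mem_upperCentralSeries (w := (w : M)) (x := (x : M)) (hZ hw)
        (by simpa using hwx)
      exact Subtype.ext h)
    (W := W.subgroupOf R) (IsPGroup.of_card hcardW)
    (fun w hw => (hWY hw).2) (relIndex_dvd_index_of_normal Z R)
    index_ne_zero_of_finite
  rw [hcardW] at key
  exact (Nat.pow_dvd_pow_iff_le_right hq.one_lt).1 key

/-- The order of a finite hypercentral extension `M` of `C` that is generated, as a normal
subgroup, by the image of `Γ`. -/
theorem card_le_mul_sizeBound {Γ : Type v} {M : Type u} {C : Type w} [Group Γ] [Group M] [Group C]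
    [Finite Γ] [Finite M] (f : Γ →* M) (hf : normalClosure (Set.range f) = ⊤) (K : Subgroup Γ)
    [K.Normal] (hK : K ≤ f.ker) (π : M →* C) (hπ : Function.Surjective π) {n : ℕ}
    (hker : π.ker ≤ Subgroup.upperCentralSeries M n) :
    (Nat.card M : ℝ) ≤ (Nat.card (Γ ⧸ K) : ℝ) * sizeBound (Nat.card C) := by
  -- The lower central series becomes constant; its last member is the nilpotent residual.
  obtain ⟨m, hm⟩ := WellFoundedLT.antitone_chain_condition
    (f := (⊤ : Subgroup M).lowerCentralSeries) (Subgroup.lowerCentralSeries_antitone ⊤)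
  let N := (⊤ : Subgroup M).lowerCentralSeries m
  have hN : ∀ k, N ≤ (⊤ : Subgroup M).lowerCentralSeries k := fun k => by
    rcases le_total m k with h | h
    · exact (hm k h).le
    · exact Subgroup.lowerCentralSeries_antitone _ h
  have hnil : Group.IsNilpotent (M ⧸ N) := Subgroup.nilpotent_iff_lowerCentralSeries.2 ⟨m, by
    have h := map_lowerCentralSeries (⊤ : Subgroup M) (QuotientGroup.mk' N) m
    rw [← MonoidHom.range_eq_map, QuotientGroup.range_mk'] at h
    rw [← h, Subgroup.map_eq_bot_iff, QuotientGroup.ker_mk']⟩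
  have hquot : Nat.card (M ⧸ N) ≤ Nat.card (Γ ⧸ K) := by
    let g : Γ →* M ⧸ N := (QuotientGroup.mk' N).comp f
    have hg : Function.Surjective g := by
      refine surjective_of_normalClosure_eq_top g ?_
      have h := map_normalClosure (Set.range f) (QuotientGroup.mk' N)
        (QuotientGroup.mk'_surjective N)
      rw [hf, ← MonoidHom.range_eq_map, QuotientGroup.range_mk', ← Set.range_comp] at h
      exact h.symm
    refine Nat.card_le_card_of_surjective (QuotientGroup.lift K g fun a ha => ?_) ?_
    · rw [MonoidHom.mem_ker, MonoidHom.comp_apply, MonoidHom.mem_ker.1 (hK ha), map_one]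
    · exact QuotientGroup.lift_surjective_of_surjective _ _ hg _
  have hindex : π.ker.index = Nat.card C := by
    rw [index_ker, MonoidHom.range_eq_top.2 hπ, card_top]
  have hCfin : Finite C := Finite.of_surjective π hπ
  have hres : (Nat.card N : ℝ) ≤ sizeBound (Nat.card C) := by
    have h1 : Nat.card N ≤ Nat.card C * Nat.card (N ⊓ π.ker : Subgroup M) := by
      have h := relIndex_mul_relIndex ⊥ (N ⊓ π.ker) N bot_le inf_le_left
      rw [relIndex_bot_left, relIndex_bot_left, inf_relIndex_left] at h
      rw [← h, mul_comm, ← hindex]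
      exact Nat.mul_le_mul_right _ (Nat.le_of_dvd
        (Nat.pos_of_ne_zero index_ne_zero_of_finite) (relIndex_dvd_index_of_normal _ _))
    refine le_trans (by exact_mod_cast h1) (mul_le_sizeBound Nat.card_pos.ne' Nat.card_pos.ne'
      fun q hq => ?_)
    rw [← hindex]
    exact factorization_card_inf_le π.ker N hker hN hq
  rw [card_eq_card_quotient_mul_card_subgroup N, Nat.cast_mul]
  gcongr

end HypercentralBound

/-! ### Centrality, finiteness and functoriality of the free normal closure -/

open scoped commutatorElement

namespace NormalClosure

variable {Γ : Type u} {G : Type v} [Group Γ] [Group G] (φ : Γ →* G)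

theorem act_unit (g : G) (a : Γ) : act φ g (unit φ a) = gen φ g a := by
  change act φ g (gen φ 1 a) = _
  rw [act_gen, mul_one]

theorem gen_counit (x : NormalClosure φ) (a : Γ) :
    gen φ (counit φ x) a = x * unit φ a * x⁻¹ := by
  rw [← act_unit]
  exact (normalMap φ).peiffer x (unit φ a)

theorem ker_counit_le_center : (counit φ).ker ≤ Subgroup.center (NormalClosure φ) := by
  intro x hx
  refine Subgroup.mem_center_iff.2 fun y => ?_
  have h := (normalMap φ).peiffer x y
  change act φ (counit φ x) y = _ at h
  rw [MonoidHom.mem_ker.1 hx, map_one, MulAut.one_apply] at h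
  exact eq_mul_inv_iff_mul_eq.1 h

theorem eq_top_of_gen_mem {H : Subgroup (NormalClosure φ)} (h : ∀ g a, gen φ g a ∈ H) : H = ⊤ :=
  top_le_iff.1 fun x _ => PresentedGroup.generated_by _ H (fun y => h y.1 y.2) x

theorem counit_surjective (h : Subgroup.normalClosure (Set.range φ) = ⊤) :
    Function.Surjective (counit φ) := by
  rw [← MonoidHom.range_eq_top, ← top_le_iff, ← h]
  have : (counit φ).range.Normal := ⟨by
    rintro _ ⟨x, rfl⟩ g
    exact ⟨act φ g x, (normalMap φ).hom_act g x⟩⟩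
  refine Subgroup.normalClosure_le_normal ?_
  rintro _ ⟨a, rfl⟩
  exact ⟨unit φ a, counit_unit φ a⟩

theorem normalClosure_range_unit (h : Function.Surjective (counit φ)) :
    Subgroup.normalClosure (Set.range (unit φ)) = ⊤ := by
  refine eq_top_of_gen_mem φ fun g a => ?_
  obtain ⟨x, rfl⟩ := h g
  rw [gen_counit]
  exact Subgroup.normalClosure_normal.conj_mem _ (Subgroup.subset_normalClosure (Set.mem_range_self a)) x

/-- `unit φ` carries `ker φ` into the kernel of `counit φ`, which is central. -/
theorem commutator_le_ker_unit (K : Subgroup Γ) (hK : K ≤ φ.ker) : ⁅(⊤ : Subgroup Γ), K⁆ ≤ (unit φ).ker := by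
  refine Subgroup.commutator_le.2 fun a _ b hb => ?_
  have hc : unit φ b ∈ Subgroup.center (NormalClosure φ) := ker_counit_le_center φ (by
    rw [MonoidHom.mem_ker, counit_unit]
    exact hK hb)
  rw [MonoidHom.mem_ker, map_commutatorElement, commutatorElement_eq_one_iff_mul_comm]
  exact Subgroup.mem_center_iff.1 hc _

/-- Commutators depend only on images in `G`, so there are finitely many, and by Schur's theorem the
derived subgroup is finite. Every generator is conjugate to an element of `unit φ`'s image, so the
abelianization is a quotient of `Γ`. -/
theorem finite_of_counit_surjective [Finite Γ] [Finite G] (h : Function.Surjective (counit φ)) :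
    Finite (NormalClosure φ) := by
  have : Finite (commutatorSet (NormalClosure φ)) := by
    obtain ⟨s, hs⟩ := h.hasRightInverse
    have hz : ∀ x, ∃ z ∈ Subgroup.center (NormalClosure φ), x = s (counit φ x) * z := fun x =>
      ⟨(s (counit φ x))⁻¹ * x, ker_counit_le_center φ (by
        rw [MonoidHom.mem_ker, map_mul, map_inv, hs, inv_mul_cancel]), by simp⟩
    refine Set.Finite.subset (Set.finite_range fun p : G × G => ⁅s p.1, s p.2⁆) ?_
    rintro _ ⟨x, y, rfl⟩
    refine ⟨(counit φ x, counit φ y), ?_⟩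
    obtain ⟨z, hz1, hz2⟩ := hz x
    obtain ⟨w, hw1, hw2⟩ := hz y
    have h1 : ∀ b, ⁅x, b⁆ = ⁅s (counit φ x), b⁆ := fun b => by
      conv_lhs => rw [hz2]
      rw [commutatorElement_def, commutatorElement_def, mul_inv_rev, mul_assoc (s _) z b,
        ← Subgroup.mem_center_iff.1 hz1 b]
      group
    have h2 : ∀ b, ⁅b, y⁆ = ⁅b, s (counit φ y)⁆ := fun b => by
      conv_lhs => rw [hw2]
      rw [commutatorElement_def, commutatorElement_def, mul_inv_rev, ← mul_assoc b,
        mul_assoc _ w, ← Subgroup.mem_center_iff.1 hw1 b⁻¹]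
      group
    change ⁅s (counit φ x), s (counit φ y)⁆ = ⁅x, y⁆
    rw [h1, h2]
  have : Finite (NormalClosure φ ⧸ commutator (NormalClosure φ)) := by
    let f : Γ →* Abelianization (NormalClosure φ) := Abelianization.of.comp (unit φ)
    refine Finite.of_surjective f ?_
    have htop : f.range.comap Abelianization.of = ⊤ := eq_top_of_gen_mem φ fun g a => by
      obtain ⟨x, rfl⟩ := h g
      refine ⟨a, ?_⟩
      rw [gen_counit, map_mul, map_mul, map_inv, mul_right_comm, mul_inv_cancel, one_mul]
      rfl
    intro y
    obtain ⟨x, rfl⟩ := QuotientGroup.mk_surjective y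
    exact (htop ▸ Subgroup.mem_top x : x ∈ f.range.comap Abelianization.of)
  exact Finite.of_subgroup_quotient (commutator (NormalClosure φ))

section Map

variable {φ} {Λ : Type*} {H : Type*} [Group Λ] [Group H] {ψ : Λ →* H}

/-- The free normal closure is functorial. -/
def map (p : Γ →* Λ) (f : G →* H) (hf : ∀ a, f (φ a) = ψ (p a)) :
    NormalClosure φ →* NormalClosure ψ :=
  toGroup (fun g a => gen ψ (f g) (p a)) (fun g a b => by rw [map_mul, gen_mul])
    (fun g h a b => by rw [gen_conj]; simp [hf])

theorem map_gen (p : Γ →* Λ) (f : G →* H) (hf : ∀ a, f (φ a) = ψ (p a)) (g : G) (a : Γ) :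
    map p f hf (gen φ g a) = gen ψ (f g) (p a) :=
  toGroup_gen _ _ _ _ _

theorem map_unit (p : Γ →* Λ) (f : G →* H) (hf : ∀ a, f (φ a) = ψ (p a)) (a : Γ) :
    map p f hf (unit φ a) = unit ψ (p a) :=
  (map_gen p f hf 1 a).trans (by rw [map_one]; rfl)

theorem counit_map (p : Γ →* Λ) (f : G →* H) (hf : ∀ a, f (φ a) = ψ (p a))
    (x : NormalClosure φ) : counit ψ (map p f hf x) = f (counit φ x) := by
  have : (counit ψ).comp (map p f hf) = f.comp (counit φ) := hom_ext fun g a => by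
    simp [map_gen, counit_gen, hf]
  exact DFunLike.congr_fun this x

/-- Replacing `Γ` by a quotient by a subgroup of the kernel of `Γ → Γ^φ` does not change the free
normal closure. -/
def congr (p : Γ →* Λ) (hp : Function.Surjective p) (hker : p.ker ≤ (unit φ).ker) (e : G ≃* H)
    (he : ∀ a, e (φ a) = ψ (p a)) : NormalClosure φ ≃* NormalClosure ψ :=
  -- A generator is a translate of `unit φ a`, so a merely set-theoretic section of `p` yields a
  -- well-defined inverse.
  have hgen : ∀ g a b, p a = p b → gen φ g a = gen φ g b := fun g a b hab => by
    have h : a * b⁻¹ ∈ (unit φ).ker := hker (by simp [MonoidHom.mem_ker, hab])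
    rw [MonoidHom.mem_ker, map_mul, map_inv, mul_inv_eq_one] at h
    rw [← act_unit, h, act_unit]
  have hs := Function.surjInv_eq hp
  have he' : ∀ a, e.toMonoidHom (φ a) = ψ (p a) := he
  MonoidHom.toMulEquiv (map p e.toMonoidHom he')
    (toGroup (fun h l => gen φ (e.symm h) (Function.surjInv hp l))
      (fun h l m => by
        rw [← gen_mul]
        exact hgen _ _ _ (by simp [hs]))
      (fun g h l m => by
        rw [gen_conj]
        congr 1
        have hl : e.symm (ψ l) = φ (Function.surjInv hp l) := by
          rw [MulEquiv.symm_apply_eq, he, hs]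
        simp [hl]))
    (hom_ext fun g a => by
      rw [MonoidHom.comp_apply, map_gen, toGroup_gen, MonoidHom.id_apply, hgen _ _ a (hs _)]
      exact congrArg (gen φ · a) (e.symm_apply_apply g))
    (hom_ext fun h l => by
      rw [MonoidHom.comp_apply, toGroup_gen, map_gen, MonoidHom.id_apply, hs]
      exact congrArg (gen ψ · l) (e.apply_symm_apply h))

end Map

end NormalClosure

/-! ### Maps between towers -/

section TowerMaps

variable {Γ Λ G H : Type u} [Group Γ] [Group Λ] [Group G] [Group H]

theorem step_towerMap (φ : Γ →* G) (i : ℕ) (a : Γ) :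
    step φ i (towerMap φ (i + 1) a) = towerMap φ i a :=
  NormalClosure.counit_unit (towerMap φ i) a

/-- The composite structure map of the tower from index `j` down to index `i ≤ j`. -/
def down (φ : Γ →* G) {i j : ℕ} (h : i ≤ j) : Tower φ j →* Tower φ i :=
  Nat.leRecOn (C := fun j => Tower φ j →* Tower φ i) h (fun {k} f => f.comp (step φ k))
    (MonoidHom.id _)

variable (φ : Γ →* G)

theorem down_self {i : ℕ} (x : Tower φ i) : down φ le_rfl x = x := by
  rw [down, Nat.leRecOn_self]
  rfl

theorem down_step {i j : ℕ} (h : i ≤ j) (x : Tower φ (j + 1)) :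
    down φ h (step φ j x) = down φ (h.trans j.le_succ) x := by
  conv_rhs => rw [down, Nat.leRecOn_succ h]
  rfl

theorem step_eq_down {i : ℕ} (x : Tower φ (i + 1)) : step φ i x = down φ i.le_succ x := by
  rw [← down_step φ le_rfl, down_self]

theorem down_down {i j k : ℕ} (h : i ≤ j) (h' : j ≤ k) (x : Tower φ k) :
    down φ h (down φ h' x) = down φ (h.trans h') x := by
  induction k, h' using Nat.le_induction with
  | base => rw [down_self]
  | succ k hk ih => rw [← down_step φ hk, ih, down_step]

theorem down_towerMap {i j : ℕ} (h : i ≤ j) (a : Γ) :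
    down φ h (towerMap φ j a) = towerMap φ i a := by
  induction j, h using Nat.le_induction with
  | base => rw [down_self]
  | succ j hj ih => rw [← down_step φ hj, step_towerMap, ih]

/-- The generator `(x, a)` of a member of the tower. -/
def towerGen (i : ℕ) (x : Tower φ i) (a : Γ) : Tower φ (i + 1) :=
  NormalClosure.gen (towerMap φ i) x a

theorem tower_hom_ext {i : ℕ} {M : Type*} [Group M] {α β : Tower φ (i + 1) →* M}
    (h : ∀ x a, α (towerGen φ i x a) = β (towerGen φ i x a)) : α = β :=
  NormalClosure.hom_ext (φ := towerMap φ i) h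

theorem step_towerGen_eq_conj (i : ℕ) (x : Tower φ i) (a : Γ) :
    step φ i (towerGen φ i x a) = x * towerMap φ i a * x⁻¹ :=
  NormalClosure.counit_gen (towerMap φ i) x a

/-- Both sides are the conjugate of `towerMap φ (i + 1) a` by `x`, the right one by the Peiffer
identity. -/
theorem step_towerGen (i : ℕ) (x : Tower φ (i + 1)) (a : Γ) :
    step φ (i + 1) (towerGen φ (i + 1) x a) = towerGen φ i (step φ i x) a :=
  (step_towerGen_eq_conj φ (i + 1) x a).trans
    (NormalClosure.gen_counit (towerMap φ i) x a).symm

theorem down_towerGen {i j : ℕ} (h : i ≤ j) (x : Tower φ j) (a : Γ) :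
    down φ (Nat.succ_le_succ h) (towerGen φ j x a) = towerGen φ i (down φ h x) a := by
  induction j, h using Nat.le_induction with
  | base => rw [down_self, down_self]
  | succ j hj ih => rw [← down_step φ (Nat.succ_le_succ hj), ← down_step φ hj, ← ih, step_towerGen]

variable {φ} {ψ : Λ →* H}

/-- The map of towers induced by a commutative square. -/
def towerHom (p : Γ →* Λ) (f : G →* H) (hf : ∀ a, f (φ a) = ψ (p a)) : ∀ i,
    {F : Tower φ i →* Tower ψ i // ∀ a, F (towerMap φ i a) = towerMap ψ i (p a)}
  | 0 => ⟨f, hf⟩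
  | i + 1 => ⟨NormalClosure.map p (towerHom p f hf i).1 (towerHom p f hf i).2,
      NormalClosure.map_unit _ _ _⟩

theorem towerHom_towerGen (p : Γ →* Λ) (f : G →* H) (hf : ∀ a, f (φ a) = ψ (p a)) (i : ℕ)
    (x : Tower φ i) (a : Γ) :
    (towerHom p f hf (i + 1)).1 (towerGen φ i x a) =
      towerGen ψ i ((towerHom p f hf i).1 x) (p a) :=
  NormalClosure.map_gen p (towerHom p f hf i).1 (towerHom p f hf i).2 x a

theorem step_towerHom (p : Γ →* Λ) (f : G →* H) (hf : ∀ a, f (φ a) = ψ (p a)) (i : ℕ)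
    (x : Tower φ (i + 1)) :
    step ψ i ((towerHom p f hf (i + 1)).1 x) = (towerHom p f hf i).1 (step φ i x) :=
  NormalClosure.counit_map p (towerHom p f hf i).1 (towerHom p f hf i).2 x

theorem down_towerHom (p : Γ →* Λ) (f : G →* H) (hf : ∀ a, f (φ a) = ψ (p a)) {i j : ℕ}
    (h : i ≤ j) (x : Tower φ j) :
    down ψ h ((towerHom p f hf j).1 x) = (towerHom p f hf i).1 (down φ h x) := by
  induction j, h using Nat.le_induction with
  | base => rw [down_self, down_self]
  | succ j hj ih => rw [← down_step ψ hj, step_towerHom, ih, down_step]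

/-- The map from the tower of `φ`, shifted by `k`, to the tower of `ψ` that is induced by a
homomorphism from the `k`-th member of the former to the target of `ψ`. -/
def shiftHom {ψ : Γ →* H} (k : ℕ) (f : Tower φ k →* H) (hf : ∀ a, f (towerMap φ k a) = ψ a) : ∀ i,
    {F : Tower φ (k + i) →* Tower ψ i // ∀ a, F (towerMap φ (k + i) a) = towerMap ψ i a}
  | 0 => ⟨f, hf⟩
  | i + 1 => ⟨NormalClosure.map (MonoidHom.id Γ) (shiftHom k f hf i).1 (shiftHom k f hf i).2,
      NormalClosure.map_unit _ _ _⟩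

theorem shiftHom_towerGen {ψ : Γ →* H} (k : ℕ) (f : Tower φ k →* H)
    (hf : ∀ a, f (towerMap φ k a) = ψ a) (i : ℕ) (x : Tower φ (k + i)) (a : Γ) :
    (shiftHom k f hf (i + 1)).1 (towerGen φ (k + i) x a) =
      towerGen ψ i ((shiftHom k f hf i).1 x) a :=
  NormalClosure.map_gen (MonoidHom.id Γ) (shiftHom k f hf i).1 (shiftHom k f hf i).2 x a

theorem step_shiftHom {ψ : Γ →* H} (k : ℕ) (f : Tower φ k →* H)
    (hf : ∀ a, f (towerMap φ k a) = ψ a) (i : ℕ) (x : Tower φ (k + i + 1)) :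
    step ψ i ((shiftHom k f hf (i + 1)).1 x) = (shiftHom k f hf i).1 (step φ (k + i) x) :=
  NormalClosure.counit_map (MonoidHom.id Γ) (shiftHom k f hf i).1 (shiftHom k f hf i).2 x

/-- With `shiftHom_towerHom`, this interleaves the two towers; the maps are compared on generators.
-/
theorem towerHom_shiftHom {ψ : Γ →* H} (k : ℕ) (f : Tower φ k →* H)
    (hf : ∀ a, f (towerMap φ k a) = ψ a) (g : H →* G) (hg : ∀ a, g (ψ a) = φ a)
    (hgf : ∀ x, g (f x) = down φ k.zero_le x) (i : ℕ) (x : Tower φ (k + i)) :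
    (towerHom (MonoidHom.id Γ) g hg i).1 ((shiftHom k f hf i).1 x) =
      down φ (Nat.le_add_left i k) x := by
  induction i with
  | zero => exact hgf x
  | succ i ih =>
    have : (towerHom (MonoidHom.id Γ) g hg (i + 1)).1.comp (shiftHom k f hf (i + 1)).1 =
        down φ (Nat.succ_le_succ (Nat.le_add_left i k)) := by
      refine tower_hom_ext (i := k + i) φ fun y a => ?_
      rw [down_towerGen _ (Nat.le_add_left i k), ← ih, MonoidHom.comp_apply,
        shiftHom_towerGen, towerHom_towerGen]
      rfl
    exact DFunLike.congr_fun this x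

theorem shiftHom_towerHom {ψ : Γ →* H} (k : ℕ) (f : Tower φ k →* H)
    (hf : ∀ a, f (towerMap φ k a) = ψ a) (g : H →* G) (hg : ∀ a, g (ψ a) = φ a)
    (hginj : Function.Injective g)
    (hgf : ∀ x, g (f x) = down φ k.zero_le x) (i : ℕ) (x : Tower ψ (k + i)) :
    (shiftHom k f hf i).1 ((towerHom (MonoidHom.id Γ) g hg (k + i)).1 x) =
      down ψ (Nat.le_add_left i k) x := by
  induction i with
  | zero =>
    -- Injectivity of `g` reduces the claim to compatibility of `towerHom` with `down`.
    refine hginj ((hgf _).trans ?_)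
    exact down_towerHom _ _ _ k.zero_le x
  | succ i ih =>
    have : (shiftHom k f hf (i + 1)).1.comp (towerHom (MonoidHom.id Γ) g hg (k + i + 1)).1 =
        down ψ (Nat.succ_le_succ (Nat.le_add_left i k)) := by
      refine tower_hom_ext (i := k + i) ψ fun y a => ?_
      rw [down_towerGen _ (Nat.le_add_left i k), ← ih, MonoidHom.comp_apply,
        towerHom_towerGen, shiftHom_towerGen]
      rfl
    exact DFunLike.congr_fun this x

end TowerMaps

/-! ### Inverse limits -/

section Limits

variable {Γ G : Type u} [Group Γ] [Group G] (φ : Γ →* G)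

theorem limit_step (x : limit φ) (i : ℕ) : step φ i (x.1 (i + 1)) = x.1 i := x.2 i

theorem down_limit (x : limit φ) {i j : ℕ} (h : i ≤ j) : down φ h (x.1 j) = x.1 i := by
  induction j, h using Nat.le_induction with
  | base => rw [down_self]
  | succ j hj ih => rw [← down_step φ hj, limit_step, ih]

variable {φ} in
theorem TerminatesAt.down_bijective {t : ℕ} (ht : TerminatesAt φ t) {j : ℕ} (h : t ≤ j) :
    Function.Bijective (down φ h) := by
  induction j, h using Nat.le_induction with
  | base =>
    have : ⇑(down φ (le_refl t)) = id := funext fun x => down_self φ x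
    rw [this]
    exact Function.bijective_id
  | succ j hj ih =>
    have : ⇑(down φ (hj.trans j.le_succ)) = down φ hj ∘ step φ j :=
      funext fun x => (down_step φ hj x).symm
    rw [this]
    exact ih.comp (ht j hj)

variable {φ} in
theorem TerminatesAt.proj_bijective {t : ℕ} (ht : TerminatesAt φ t) :
    Function.Bijective (proj φ t) := by
  constructor
  · intro x y hxy
    change x.1 t = y.1 t at hxy
    have hge : ∀ j, t ≤ j → x.1 j = y.1 j := fun j hj =>
      (ht.down_bijective hj).1 (by rw [down_limit, down_limit, hxy])
    refine Subtype.ext (funext fun i => ?_)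
    rw [← down_limit φ x (Nat.le_add_right i t), ← down_limit φ y (Nat.le_add_right i t),
      hge _ (Nat.le_add_left t i)]
  · intro y
    -- Lifting `y` to index `j + t` and projecting to `j` gives coordinates below `t` as well.
    choose w hw using fun j : ℕ => (ht.down_bijective (Nat.le_add_left t j)).2 y
    refine ⟨⟨fun i => down φ (Nat.le_add_right i t) (w i), fun i => ?_⟩, ?_⟩
    · have h : down φ (Nat.add_le_add_right i.le_succ t) (w (i + 1)) = w i :=
        (ht.down_bijective (Nat.le_add_left t i)).1 (by rw [down_down, hw, hw])
      change step φ i (down φ _ (w (i + 1))) = down φ _ (w i)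
      rw [step_eq_down, down_down, ← h, down_down]
    · exact hw t

variable {φ}

/-- The map of inverse limits induced by a map from the shifted tower. -/
def limitShiftHom {H : Type u} [Group H] {ψ : Γ →* H} (k : ℕ) (f : Tower φ k →* H)
    (hf : ∀ a, f (towerMap φ k a) = ψ a) : limit φ →* limit ψ :=
  MonoidHom.mk' (fun x => ⟨fun i => (shiftHom k f hf i).1 (x.1 (k + i)), fun i => by
      rw [step_shiftHom]
      exact congrArg _ (limit_step φ x (k + i))⟩)
    (fun x y => Subtype.ext (funext fun i => map_mul (shiftHom k f hf i).1 _ _))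

/-- The map of inverse limits induced by a map of towers. -/
def limitHom {H : Type u} [Group H] {ψ : Γ →* H} (f : G →* H) (hf : ∀ a, f (φ a) = ψ a) :
    limit φ →* limit ψ :=
  MonoidHom.mk' (fun x => ⟨fun i => (towerHom (MonoidHom.id Γ) f hf i).1 (x.1 i), fun i => by
      rw [step_towerHom, limit_step]⟩)
    (fun x y => Subtype.ext (funext fun i => map_mul (towerHom (MonoidHom.id Γ) f hf i).1 _ _))

/-- If some member of the tower of `φ` maps to `G` through a subgroup `H` containing the image of
`φ`, then the tower of the corestriction of `φ` to `H` has the same inverse limit. -/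
def limitEquiv {H : Type u} [Group H] {ψ : Γ →* H} (k : ℕ) (f : Tower φ k →* H)
    (hf : ∀ a, f (towerMap φ k a) = ψ a) (g : H →* G) (hg : ∀ a, g (ψ a) = φ a)
    (hginj : Function.Injective g) (hgf : ∀ x, g (f x) = down φ k.zero_le x) :
    limit φ ≃* limit ψ :=
  MonoidHom.toMulEquiv (limitShiftHom k f hf) (limitHom g hg)
    (MonoidHom.ext fun x => Subtype.ext (funext fun i =>
      (towerHom_shiftHom k f hf g hg hgf i _).trans (down_limit φ x _)))
    (MonoidHom.ext fun x => Subtype.ext (funext fun i =>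
      (shiftHom_towerHom k f hf g hg hginj hgf i _).trans (down_limit ψ x _)))

end Limits

/-! ### Termination of the two series -/

section SeriesTermination

theorem exists_forall_ge_eq_iInf {M : Type u} [Group M] [Finite M] (f : ℕ → Subgroup M)
    (hf : Antitone f) : ∃ t, ∀ i, t ≤ i → f i = ⨅ i, f i := by
  obtain ⟨t, ht⟩ := WellFoundedLT.antitone_chain_condition hf
  refine ⟨t, fun i hi => le_antisymm (le_iInf fun j => ?_) (iInf_le f i)⟩
  rw [← ht i hi]
  rcases le_total t j with h | h
  · exact (ht j h).le
  · exact hf h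

variable {Γ : Type u} {G : Type v} [Group Γ] [Group G]

theorem closureSeries_antitone (H : Subgroup G) : Antitone (closureSeries H) := by
  refine antitone_nat_of_succ_le fun i => ?_
  induction i with
  | zero => exact le_top
  | succ i ih =>
    refine Subgroup.closure_mono ?_
    rintro _ ⟨c, hc, h, hh, rfl⟩
    exact ⟨c, ih hc, h, hh, rfl⟩

theorem kerSeries_antitone (φ : Γ →* G) : Antitone (kerSeries φ) := by
  refine antitone_nat_of_succ_le fun i => ?_
  have := kerSeries_normal φ i
  exact Subgroup.commutator_le_right _ _

theorem exists_closureSeries_eq [Finite G] (φ : Γ →* G) :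
    ∃ t, ∀ i, t ≤ i → closureSeries φ.range i = subnormalClosure φ :=
  exists_forall_ge_eq_iInf _ (closureSeries_antitone _)

theorem exists_kerSeries_eq [Finite Γ] (φ : Γ →* G) :
    ∃ t, ∀ i, t ≤ i → kerSeries φ i = kerTerminal φ :=
  exists_forall_ge_eq_iInf _ (kerSeries_antitone φ)

theorem normalClosure_range_inducedRho [Finite G] (φ : Γ →* G) :
    Subgroup.normalClosure (Set.range (inducedRho φ)) = ⊤ := by
  obtain ⟨t, ht⟩ := exists_closureSeries_eq φ
  have h : subnormalClosure φ ≤ (Subgroup.normalClosure (Set.range (inducedRho φ))).map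
      (subnormalClosure φ).subtype := by
    conv_lhs => rw [← ht (t + 1) t.le_succ]
    refine (Subgroup.closure_le _).2 ?_
    rintro _ ⟨c, hc, _, ⟨a, rfl⟩, rfl⟩
    rw [ht t le_rfl] at hc
    exact ⟨⟨c, hc⟩ * inducedRho φ a * ⟨c, hc⟩⁻¹, Subgroup.normalClosure_normal.conj_mem _
      (Subgroup.subset_normalClosure (Set.mem_range_self a)) _, rfl⟩
  refine top_le_iff.1 fun x _ => ?_
  obtain ⟨y, hy, hyx⟩ := h x.2
  exact Subtype.ext hyx ▸ hy

end SeriesTermination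

/-! ### Images, kernels and finiteness of the tower members -/

section TowerStructure

variable {Γ G : Type u} [Group Γ] [Group G] (φ : Γ →* G)

/-- The generator `(y, a)` goes to the conjugate of `φ a` by the image of `y`, which inductively
lies in the previous member of the series. -/
theorem down_mem_closureSeries (k : ℕ) (x : Tower φ k) :
    (down φ k.zero_le x : G) ∈ closureSeries φ.range k := by
  induction k with
  | zero => exact Subgroup.mem_top _
  | succ k ih =>
    have h : (closureSeries φ.range (k + 1)).comap
        (down φ (k + 1).zero_le : Tower φ (k + 1) →* G) = ⊤ := by
      refine NormalClosure.eq_top_of_gen_mem (towerMap φ k) fun y a => ?_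
      refine Subgroup.subset_closure ⟨down φ k.zero_le y, ih y, φ a, ⟨a, rfl⟩, ?_⟩
      refine (down_step φ k.zero_le (towerGen φ k y a)).symm.trans ?_
      rw [step_towerGen_eq_conj, map_mul, map_mul, map_inv, down_towerMap]
      rfl
    exact (h ▸ Subgroup.mem_top x : x ∈ (closureSeries φ.range (k + 1)).comap
        (down φ (k + 1).zero_le : Tower φ (k + 1) →* G))

theorem kerSeries_le_ker_towerMap (i : ℕ) : kerSeries φ i ≤ (towerMap (inducedRho φ) i).ker := by
  induction i with
  | zero => exact fun a ha => Subtype.ext ha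
  | succ i ih => exact NormalClosure.commutator_le_ker_unit (towerMap (inducedRho φ) i) _ ih

theorem kerTerminal_le_ker_towerMap (i : ℕ) :
    kerTerminal φ ≤ (towerMap (inducedRho φ) i).ker :=
  (iInf_le _ i).trans (kerSeries_le_ker_towerMap φ i)

/-- The isomorphism between the towers of `Γ → 𝒞` and `Γ/𝒦 → 𝒞`. -/
def towerEquiv : ∀ i, {F : Tower (inducedRho φ) i ≃* Tower (inducedPsi φ) i //
    ∀ a, F (towerMap (inducedRho φ) i a) = towerMap (inducedPsi φ) i (a : Γ ⧸ kerTerminal φ)}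
  | 0 => ⟨MulEquiv.refl (subnormalClosure φ), fun _ => rfl⟩
  | i + 1 => ⟨NormalClosure.congr (QuotientGroup.mk' (kerTerminal φ))
      (QuotientGroup.mk'_surjective _)
      ((QuotientGroup.ker_mk' (kerTerminal φ)).le.trans (kerTerminal_le_ker_towerMap φ (i + 1)))
      (towerEquiv i).1 (towerEquiv i).2,
      NormalClosure.map_unit (QuotientGroup.mk' (kerTerminal φ)) (towerEquiv i).1.toMonoidHom
        (towerEquiv i).2⟩

theorem towerEquiv_step (i : ℕ) (x : Tower (inducedRho φ) (i + 1)) :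
    (towerEquiv φ i).1 (step (inducedRho φ) i x) =
      step (inducedPsi φ) i ((towerEquiv φ (i + 1)).1 x) :=
  (NormalClosure.counit_map (QuotientGroup.mk' (kerTerminal φ)) (towerEquiv φ i).1.toMonoidHom
    (towerEquiv φ i).2 x).symm

/-- The isomorphism of inverse limits induced by `towerEquiv`. -/
def limitTowerEquiv : limit (inducedRho φ) ≃* limit (inducedPsi φ) where
  toFun x := ⟨fun i => (towerEquiv φ i).1 (x.1 i), fun i => by
    rw [← towerEquiv_step, limit_step]⟩
  invFun y := ⟨fun i => (towerEquiv φ i).1.symm (y.1 i), fun i => by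
    rw [MulEquiv.eq_symm_apply, towerEquiv_step, MulEquiv.apply_symm_apply, limit_step]⟩
  left_inv x := Subtype.ext (funext fun i => (towerEquiv φ i).1.symm_apply_apply _)
  right_inv y := Subtype.ext (funext fun i => (towerEquiv φ i).1.apply_symm_apply _)
  map_mul' x y := Subtype.ext (funext fun i => map_mul (towerEquiv φ i).1 _ _)

variable {φ} in
theorem terminatesAt_inducedPsi {t : ℕ} (ht : TerminatesAt (inducedRho φ) t) :
    TerminatesAt (inducedPsi φ) t := fun i hi => by
  have h : ⇑(step (inducedPsi φ) i) =
      (towerEquiv φ i).1 ∘ step (inducedRho φ) i ∘ (towerEquiv φ (i + 1)).1.symm :=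
    funext fun x => by simp [towerEquiv_step]
  rw [h]
  exact (towerEquiv φ i).1.bijective.comp
    ((ht i hi).comp (towerEquiv φ (i + 1)).1.symm.bijective)

theorem comap_upperCentralSeries_le {M N : Type*} [Group M] [Group N] (f : M →* N)
    (hf : f.ker ≤ Subgroup.center M) (n : ℕ) :
    (Subgroup.upperCentralSeries N n).comap f ≤ Subgroup.upperCentralSeries M (n + 1) := by
  induction n with
  | zero =>
    rw [Subgroup.upperCentralSeries_zero, MonoidHom.comap_bot, Subgroup.upperCentralSeries_one]
    exact hf
  | succ n ih =>
    intro x hx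
    refine Subgroup.mem_upperCentralSeries_succ_iff.2 fun y => ih ?_
    rw [Subgroup.mem_comap] at hx ⊢
    have := Subgroup.mem_upperCentralSeries_succ_iff.1 hx (f y)
    simpa using this

theorem normalClosure_range_towerMap (hφ : Subgroup.normalClosure (Set.range φ) = ⊤)
    (i : ℕ) : Subgroup.normalClosure (Set.range (towerMap φ i)) = ⊤ := by
  induction i with
  | zero => exact hφ
  | succ i ih =>
    exact NormalClosure.normalClosure_range_unit _ (NormalClosure.counit_surjective _ ih)

theorem step_surjective (hφ : Subgroup.normalClosure (Set.range φ) = ⊤) (i : ℕ) :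
    Function.Surjective (step φ i) :=
  NormalClosure.counit_surjective _ (normalClosure_range_towerMap φ hφ i)

theorem down_surjective (hφ : Subgroup.normalClosure (Set.range φ) = ⊤)
    {i j : ℕ} (h : i ≤ j) : Function.Surjective (down φ h) := by
  induction j, h using Nat.le_induction with
  | base => exact fun x => ⟨x, down_self φ x⟩
  | succ j hj ih =>
    intro x
    obtain ⟨y, rfl⟩ := ih x
    obtain ⟨z, rfl⟩ := step_surjective φ hφ j y
    exact ⟨z, (down_step φ hj z).symm⟩

theorem finite_tower [Finite Γ] [Finite G]
    (hφ : Subgroup.normalClosure (Set.range φ) = ⊤) (i : ℕ) : Finite (Tower φ i) := by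
  induction i with
  | zero => exact ‹Finite G›
  | succ i ih => exact NormalClosure.finite_of_counit_surjective _ (step_surjective φ hφ i)

/-- Each structure map has central kernel and so adds at most one step to the upper central series.
-/
theorem ker_down_le_upperCentralSeries (i : ℕ) :
    (down φ i.zero_le).ker ≤ Subgroup.upperCentralSeries (Tower φ i) i := by
  induction i with
  | zero =>
    intro x hx
    rwa [MonoidHom.mem_ker, down_self] at hx
  | succ i ih =>
    refine le_trans (fun x hx => ?_) (comap_upperCentralSeries_le (step φ i)
      (NormalClosure.ker_counit_le_center (towerMap φ i)) i)
    refine ih ?_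
    rwa [MonoidHom.mem_ker, down_step]

end TowerStructure

/-! ### Uniform bound and termination for the tower of `ρ` -/

section InducedRho

variable {Γ G : Type u} [Group Γ] [Group G] [Finite Γ] [Finite G] (φ : Γ →* G)

theorem card_tower_inducedRho_le (i : ℕ) : (Nat.card (Tower (inducedRho φ) i) : ℝ) ≤
    (Nat.card (Γ ⧸ kerTerminal φ) : ℝ) * sizeBound (Nat.card (subnormalClosure φ)) := by
  have hρ := normalClosure_range_inducedRho φ
  have := finite_tower (inducedRho φ) hρ i
  exact card_le_mul_sizeBound (towerMap (inducedRho φ) i) (normalClosure_range_towerMap _ hρ i)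
    (kerTerminal φ) (kerTerminal_le_ker_towerMap φ i) (down (inducedRho φ) i.zero_le)
    (down_surjective _ hρ _) (ker_down_le_upperCentralSeries _ i)

theorem exists_terminatesAt_inducedRho : ∃ t, TerminatesAt (inducedRho φ) t := by
  have hρ := normalClosure_range_inducedRho φ
  have hfin := finite_tower (inducedRho φ) hρ
  let c : ℕ → ℕ := fun i => Nat.card (Tower (inducedRho φ) i)
  have hbdd : BddAbove (Set.range c) := by
    refine ⟨⌊(Nat.card (Γ ⧸ kerTerminal φ) : ℝ) *
      sizeBound (Nat.card (subnormalClosure φ))⌋₊, ?_⟩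
    rintro _ ⟨i, rfl⟩
    exact Nat.le_floor (card_tower_inducedRho_le φ i)
  -- From a stage of maximal order on, the surjections between finite groups cannot increase the
  -- order, so they are bijective.
  obtain ⟨t, ht⟩ := Nat.sSup_mem (Set.range_nonempty c) hbdd
  have hle : ∀ i, c i ≤ c t := fun i => ht ▸ le_csSup hbdd ⟨i, rfl⟩
  refine ⟨t, fun i hi => ?_⟩
  refine (step_surjective _ hρ i).bijective_of_nat_card_le ((hle (i + 1)).trans ?_)
  exact Nat.card_le_card_of_surjective _ (down_surjective _ hρ hi)

end InducedRho

end SubnormalTower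

end

open SubnormalTower in
theorem theorem2 {Γ G : Type u} [Group Γ] [Group G] [Finite Γ] [Finite G] (φ : Γ →* G) :
    -- the series defining `𝒞` and `𝒦` terminate, with terminal members `𝒞` and `𝒦`
    (∃ t, ∀ i, t ≤ i → closureSeries φ.range i = subnormalClosure φ) ∧
    (∃ t, ∀ i, t ≤ i → kerSeries φ i = kerTerminal φ) ∧
    -- (1) `Γ_{∞,φ} ≅ Γ_{∞,ρ}`, compatibly with the maps from `Γ` and the maps to `G`
    (∃ e₁ : limit φ ≃* limit (inducedRho φ),
      (∀ a, e₁ (toLimit φ a) = toLimit (inducedRho φ) a) ∧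
      (∀ x, (toBase (inducedRho φ) (e₁ x) : G) = toBase φ x) ∧
      -- `Γ_{∞,ρ} = (Γ/𝒦)_{∞,ψ}`: the two towers are identified by isomorphisms that are the
      -- identity on `𝒞` and are compatible with all the maps of the towers
      ∃ f : ∀ i, Tower (inducedRho φ) i ≃* Tower (inducedPsi φ) i,
        f 0 = MulEquiv.refl (subnormalClosure φ) ∧
        (∀ i x, f i (step (inducedRho φ) i x) = step (inducedPsi φ) i (f (i + 1) x)) ∧
        (∀ i a, f i (towerMap (inducedRho φ) i a) =
          towerMap (inducedPsi φ) i (a : Γ ⧸ kerTerminal φ)) ∧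
        ∃ e₂ : limit (inducedRho φ) ≃* limit (inducedPsi φ),
          (∀ i x, proj (inducedPsi φ) i (e₂ x) = f i (proj (inducedRho φ) i x)) ∧
          -- (2) both towers terminate, and `Γ_{∞,φ}` is isomorphic to their terminal members
          (∃ t₁, TerminatesAt (inducedRho φ) t₁) ∧
          (∃ t₂, TerminatesAt (inducedPsi φ) t₂) ∧
          (∀ t₁, TerminatesAt (inducedRho φ) t₁ →
            ∃ u₁ : limit φ ≃* Tower (inducedRho φ) t₁,
              ∀ x, u₁ x = proj (inducedRho φ) t₁ (e₁ x)) ∧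
          (∀ t₂, TerminatesAt (inducedPsi φ) t₂ →
            ∃ u₂ : limit φ ≃* Tower (inducedPsi φ) t₂,
              ∀ x, u₂ x = proj (inducedPsi φ) t₂ (e₂ (e₁ x)))) ∧
    -- (3) finiteness and the bound on the order
    Finite (limit φ) ∧
    (Nat.card (limit φ) : ℝ) ≤
      (Nat.card (Γ ⧸ kerTerminal φ) : ℝ) * sizeBound (Nat.card (subnormalClosure φ)) := by
  -- At this `k` the tower of `φ` maps into `𝒞`, which supplies the shift for `limitEquiv`.
  obtain ⟨k, hk⟩ := exists_closureSeries_eq φ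
  let f : Tower φ k →* subnormalClosure φ := (down φ k.zero_le : Tower φ k →* G).codRestrict
    (subnormalClosure φ) fun x => hk k le_rfl ▸ down_mem_closureSeries φ k x
  have hf : ∀ a, f (towerMap φ k a) = inducedRho φ a := fun a =>
    Subtype.ext (down_towerMap φ k.zero_le a)
  let e₁ : limit φ ≃* limit (inducedRho φ) := limitEquiv k f hf (subnormalClosure φ).subtype
    (fun _ => rfl) (subnormalClosure φ).subtype_injective (fun _ => rfl)
  obtain ⟨t, ht⟩ := exists_terminatesAt_inducedRho φ
  let u₁ : limit φ ≃* Tower (inducedRho φ) t :=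
    e₁.trans (MulEquiv.ofBijective _ ht.proj_bijective)
  refine ⟨⟨k, hk⟩, exists_kerSeries_eq φ, ⟨e₁, fun a => ?_, fun x => ?_,
    fun i => (towerEquiv φ i).1, rfl, towerEquiv_step φ, fun i => (towerEquiv φ i).2,
    limitTowerEquiv φ, fun i x => rfl, ⟨t, ht⟩, ⟨t, terminatesAt_inducedPsi ht⟩,
    fun t₁ ht₁ => ⟨e₁.trans (MulEquiv.ofBijective _ ht₁.proj_bijective), fun x => rfl⟩,
    fun t₂ ht₂ => ⟨(e₁.trans (limitTowerEquiv φ)).trans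
      (MulEquiv.ofBijective _ ht₂.proj_bijective), fun x => rfl⟩⟩, ?_, ?_⟩
  · exact Subtype.ext (funext fun i => (shiftHom k f hf i).2 a)
  · exact down_limit φ x k.zero_le
  · have := finite_tower (inducedRho φ) (normalClosure_range_inducedRho φ) t
    exact Finite.of_equiv _ u₁.symm.toEquiv
  · rw [Nat.card_congr u₁.toEquiv]
    exact card_tower_inducedRho_le φ t
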